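/- For a compact convex set $K\subset\mathbb{R}^n$ with non-empty interior (a convex body), let $|K|$ denote its Lebesgue measure, let $\mathrm{Cov}(K)$ be its covariance matrix, i.e. the $n\times n$ matrix with entries $$\mathrm{Cov}(K)_{ij}=\int_K x_ix_j\,\frac{dx}{|K|}-\int_K x_i\,\frac{dx}{|K|}\int_K x_j\,\frac{dx}{|K|},$$ and put $$\mathcal{C}(K)=\frac{|K|^2}{\det \mathrm{Cov}(K)}.$$ A convex body $K$ is called symmetric if $K=-K$. **Theorem.** For every symmetric convex body $K\subset\mathbb{R}^2$, $$\mathcal{C}(K)\ \ge\ \mathcal{C}([-1,1]^2)=144.$$ -/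

import Mathlib

open MeasureTheory

noncomputable section

/-- The covariance matrix of a set `K ⊆ ℝⁿ`,
`Cov(K)ᵢⱼ = ∫_K xᵢ xⱼ dx/|K| - (∫_K xᵢ dx/|K|) (∫_K xⱼ dx/|K|)`,
where `⨍ x in K, f x` is the average `|K|⁻¹ ∫_K f(x) dx` with respect to Lebesgue measure. -/
def covMatrix {n : ℕ} (K : Set (Fin n → ℝ)) : Matrix (Fin n) (Fin n) ℝ :=
  Matrix.of fun i j =>
    (⨍ x in K, x i * x j) - (⨍ x in K, x i) * (⨍ x in K, x j)

/-- The functional `𝒞(K) = |K|² / det Cov(K)`, with `|K|` the Lebesgue measure of `K`. -/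
def slicingC {n : ℕ} (K : Set (Fin n → ℝ)) : ℝ :=
  (volume.real K) ^ 2 / (covMatrix K).det

/-- The cube `[-1,1]ⁿ`. -/
def cube (n : ℕ) : Set (Fin n → ℝ) :=
  {x | ∀ i, x i ∈ Set.Icc (-1 : ℝ) 1}

/-- `K` is a symmetric convex body in `ℝⁿ`: a compact convex set with non-empty interior
such that `K = -K`. -/
structure IsSymmetricConvexBody {n : ℕ} (K : Set (Fin n → ℝ)) : Prop where
  convex : Convex ℝ K
  isCompact : IsCompact K
  interior_nonempty : (interior K).Nonempty
  symmetric : ∀ x, x ∈ K ↔ -x ∈ K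

end

/-! `slicingC` is invariant under linear changes of coordinates. Choose `a`, `b` in `K` maximizing
the determinant and send them to (1,1) and (1,-1). Convexity and symmetry then put the square
[-1,1]² inside `K`, and maximality puts `K` inside the diamond |x| + |y| ≤ 2
(`IsSymmetricConvexBody.exists_diamondPosition`).

The diamond makes the caps |x| > 1 and |y| > 1 disjoint. If their areas are 2h and 2k, then |K| = 4
+ 2h + 2k. Among caps of given area, ∫ x² is largest for triangular side caps and for top and bottom
caps cut as wide as the diamond allows. Both extremal statements are single-crossing comparisons of
section lengths, and they bound ∫ x² by a polynomial in h and k (`setIntegral_fst_sq_le`);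
exchanging the axes bounds ∫ y².

The product of the two bounds is at most |K|⁴/144 by `cap_moment_polynomial_le`. The determinant of
the second moments is at most ∫ x² · ∫ y², which gives the theorem. -/

/-! ### Extremal moment inequalities in one variable. -/

/-- Comparison of moments of two functions of equal integral, the difference of which changes sign
once, from nonnegative to nonpositive. -/
theorem integral_mul_le_of_single_crossing {a b : ℝ} (hab : a ≤ b) {f g w : ℝ → ℝ}
    (hf : IntervalIntegrable f volume a b) (hg : IntervalIntegrable g volume a b)
    (hw : Continuous w) (hmono : MonotoneOn w (Set.Icc a b))
    (hcross : ∀ s ∈ Set.Icc a b, ∀ t ∈ Set.Icc a b, s < t → f s < g s → f t ≤ g t)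
    (heq : ∫ t in a..b, f t = ∫ t in a..b, g t) :
    ∫ t in a..b, w t * f t ≤ ∫ t in a..b, w t * g t := by
  -- Inserting `b` keeps the set nonempty, so that the crossing point `c` is `b` when `f < g` never
  -- occurs.
  set S : Set ℝ := insert b {t | t ∈ Set.Icc a b ∧ f t < g t} with hS
  have hSsub : S ⊆ Set.Icc a b := by
    rintro t (rfl | ht)
    · exact ⟨hab, le_rfl⟩
    · exact ht.1
  have hSne : S.Nonempty := ⟨b, Set.mem_insert _ _⟩
  have hSbdd : BddBelow S := ⟨a, fun t ht => (hSsub ht).1⟩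
  set c := sInf S with hc
  have hcmem : c ∈ Set.Icc a b :=
    ⟨le_csInf hSne fun t ht => (hSsub ht).1, csInf_le hSbdd (Set.mem_insert _ _)⟩
  have hwf : IntervalIntegrable (fun t => (w t - w c) * f t) volume a b :=
    hf.continuousOn_mul (by fun_prop)
  have hwg : IntervalIntegrable (fun t => (w t - w c) * g t) volume a b :=
    hg.continuousOn_mul (by fun_prop)
  -- Both `w - w c` and `g - f` pass from nonpositive to nonnegative at `c`. Subtracting the
  -- constant `w c` is harmless because the integrals of `f` and `g` agree.
  have key : ∫ t in a..b, (w t - w c) * f t ≤ ∫ t in a..b, (w t - w c) * g t := by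
    refine intervalIntegral.integral_mono_on hab hwf hwg fun t ht => ?_
    rcases lt_trichotomy t c with h | h | h
    · have h1 : g t ≤ f t := by
        by_contra hlt
        exact absurd (csInf_le hSbdd (Set.mem_insert_of_mem _ ⟨ht, not_le.mp hlt⟩)) (not_le.mpr h)
      have h2 := hmono ht hcmem h.le
      exact mul_le_mul_of_nonpos_left h1 (by linarith)
    · simp [h]
    · obtain ⟨s, hs, hst⟩ := exists_lt_of_csInf_lt hSne h
      have h1 : f t ≤ g t := by
        rcases hs with rfl | hs
        · exact absurd ht.2 (not_le.mpr hst)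
        · exact hcross s hs.1 t ht hst hs.2
      have h2 := hmono hcmem ht h.le
      exact mul_le_mul_of_nonneg_left h1 (by linarith)
  have split : ∀ u : ℝ → ℝ, IntervalIntegrable u volume a b →
      ∫ t in a..b, (w t - w c) * u t = (∫ t in a..b, w t * u t) - w c * ∫ t in a..b, u t := by
    intro u hu
    have h1 : IntervalIntegrable (fun t => w t * u t) volume a b :=
      hu.continuousOn_mul hw.continuousOn
    rw [← intervalIntegral.integral_const_mul, ← intervalIntegral.integral_sub h1 (hu.const_mul _)]
    exact intervalIntegral.integral_congr fun t _ => by ring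
  rw [split f hf, split g hg, heq] at key
  linarith

theorem integral_eq_sub_of_polynomial {a b : ℝ} {F F' : ℝ → ℝ}
    (hF : ∀ t, HasDerivAt F (F' t) t) (hc : Continuous F') : ∫ t in a..b, F' t = F b - F a :=
  intervalIntegral.integral_eq_sub_of_hasDerivAt (fun t _ => hF t) (hc.intervalIntegrable a b)

theorem integral_cubic (a b c₀ c₁ c₂ c₃ : ℝ) :
    ∫ t in a..b, (c₀ + c₁ * t + c₂ * t ^ 2 + c₃ * t ^ 3) =
      (c₀ * b + c₁ * b ^ 2 / 2 + c₂ * b ^ 3 / 3 + c₃ * b ^ 4 / 4) -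
        (c₀ * a + c₁ * a ^ 2 / 2 + c₂ * a ^ 3 / 3 + c₃ * a ^ 4 / 4) := by
  refine integral_eq_sub_of_polynomial
    (F := fun t => c₀ * t + c₁ * t ^ 2 / 2 + c₂ * t ^ 3 / 3 + c₃ * t ^ 4 / 4) (fun t => ?_)
    (by fun_prop)
  have h1 := (hasDerivAt_id t).const_mul c₀
  have h2 := ((hasDerivAt_pow 2 t).const_mul c₁).div_const 2
  have h3 := ((hasDerivAt_pow 3 t).const_mul c₂).div_const 3
  have h4 := ((hasDerivAt_pow 4 t).const_mul c₃).div_const 4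
  refine (((h1.add h2).add h3).add h4).congr_deriv ?_
  norm_num
  ring

/-- The moment of a cap whose section lengths are starshaped with respect to the base. -/
theorem integral_sq_mul_le_of_starConcave {L : ℝ → ℝ} {h : ℝ}
    (hL : IntervalIntegrable L volume 1 2) (h0 : ∀ t, 0 ≤ L t) (h1 : h ≤ 1)
    (hstar : ∀ s t, 1 ≤ s → s < t → 0 < L t →
      2 * (t - s) / (t - 1) + (s - 1) / (t - 1) * L t ≤ L s)
    (hh : ∫ t in (1 : ℝ)..2, L t = h) :
    ∫ t in (1 : ℝ)..2, t ^ 2 * L t ≤ h + 2 * h ^ 2 / 3 + h ^ 3 / 6 := by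
  have hnn : 0 ≤ h := hh ▸ intervalIntegral.integral_nonneg (by norm_num) fun t _ => h0 t
  rcases hnn.eq_or_lt with hz | hpos
  · have : ∫ t in (1 : ℝ)..2, t ^ 2 * L t ≤ ∫ t in (1 : ℝ)..2, 4 * L t := by
      refine intervalIntegral.integral_mono_on (by norm_num)
        (hL.continuousOn_mul (by fun_prop)) (hL.const_mul _) fun t ht => ?_
      exact mul_le_mul_of_nonneg_right (by nlinarith [ht.1, ht.2]) (h0 t)
    rw [intervalIntegral.integral_const_mul, hh, ← hz] at this
    rw [← hz]
    linarith
  -- The extremal profile: sections of a triangle with base 2 at abscissa 1 and height `h`, hence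
  -- area `h`.
  · set T : ℝ → ℝ := fun t => max 0 (2 - 2 * (t - 1) / h) with hT
    have hTc : Continuous T := by fun_prop
    have left : ∀ t ∈ Set.uIcc 1 (1 + h), T t = 2 - 2 * (t - 1) / h := by
      intro t ht
      rw [Set.uIcc_of_le (by linarith)] at ht
      refine max_eq_right ?_
      have : 2 * (t - 1) / h ≤ 2 := by rw [div_le_iff₀ hpos]; linarith [ht.2]
      linarith
    have right : ∀ t ∈ Set.uIcc (1 + h) 2, T t = 0 := by
      intro t ht
      rw [Set.uIcc_of_le (by linarith)] at ht
      refine max_eq_left ?_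
      have : 2 ≤ 2 * (t - 1) / h := by rw [le_div_iff₀ hpos]; linarith [ht.1]
      linarith
    have integral_T : ∫ t in (1 : ℝ)..2, T t = h := by
      rw [← intervalIntegral.integral_add_adjacent_intervals (b := 1 + h)
        (hTc.intervalIntegrable _ _) (hTc.intervalIntegrable _ _),
        intervalIntegral.integral_congr right, intervalIntegral.integral_congr left]
      have : (fun t : ℝ => 2 - 2 * (t - 1) / h) =
          fun t => (2 + 2 / h) + (-2 / h) * t + 0 * t ^ 2 + 0 * t ^ 3 := by
        ext t; field_simp; ring
      rw [this, integral_cubic]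
      simp only [intervalIntegral.integral_zero]
      field_simp
      ring
    have integral_sq_T : ∫ t in (1 : ℝ)..2, t ^ 2 * T t = h + 2 * h ^ 2 / 3 + h ^ 3 / 6 := by
      rw [← intervalIntegral.integral_add_adjacent_intervals (b := 1 + h)
        ((by fun_prop : Continuous fun t => t ^ 2 * T t).intervalIntegrable _ _)
        ((by fun_prop : Continuous fun t => t ^ 2 * T t).intervalIntegrable _ _),
        intervalIntegral.integral_congr (g := fun _ => 0) (a := 1 + h)
          fun t ht => by simp [right t ht],
        intervalIntegral.integral_congr
          (g := fun t => 0 + 0 * t + (2 + 2 / h) * t ^ 2 + (-2 / h) * t ^ 3)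
          fun t ht => by simp only [left t ht]; field_simp; ring,
        integral_cubic]
      simp only [intervalIntegral.integral_zero]
      field_simp
      ring
    rw [← integral_sq_T]
    refine integral_mul_le_of_single_crossing (by norm_num) hL (hTc.intervalIntegrable _ _)
      (by fun_prop) (fun s hs t _ hst => by
        have := hs.1
        gcongr) ?_ (by rw [hh, integral_T])
    -- If `L t > T t`, the chord from height 2 at abscissa 1 to `L t` lies above the side of the
    -- triangle, which forces `L s ≥ T s` at every earlier `s`.
    intro s hs t ht hst hlt
    by_contra hcon
    push Not at hcon
    have hTt : 0 ≤ T t := le_max_left _ _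
    have hTt' : 2 - 2 * (t - 1) / h ≤ T t := le_max_right _ _
    have hst' := hstar s t hs.1 hst (hTt.trans_lt hcon)
    have ht1 : 0 < t - 1 := by linarith [hs.1]
    have hs1 : 0 ≤ s - 1 := by linarith [hs.1]
    refine absurd hlt (not_lt.mpr (max_le (h0 s) (le_trans ?_ hst')))
    have : (s - 1) / (t - 1) * (2 - 2 * (t - 1) / h) ≤ (s - 1) / (t - 1) * L t :=
      mul_le_mul_of_nonneg_left (hTt'.trans hcon.le) (by positivity)
    refine le_trans (le_of_eq ?_) (add_le_add_right this _)
    field_simp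
    ring

/-- The transversal moment of a cap lying below the tent `2 * (1 - t)`. -/
theorem integral_sq_mul_le_of_antitone {f : ℝ → ℝ} {k : ℝ}
    (hf : AntitoneOn f (Set.Icc 0 1)) (h0 : ∀ t ∈ Set.Icc (0 : ℝ) 1, 0 ≤ f t)
    (htent : ∀ t ∈ Set.Icc (0 : ℝ) 1, f t ≤ 2 * (1 - t))
    (hk : ∫ t in (0 : ℝ)..1, f t = k) :
    0 ≤ k ∧ k ≤ 1 ∧ ∫ t in (0 : ℝ)..1, t ^ 2 * f t ≤ (2 * k - k ^ 2) / 6 := by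
  have hint : IntervalIntegrable f volume 0 1 := by
    refine AntitoneOn.intervalIntegrable ?_
    rwa [Set.uIcc_of_le zero_le_one]
  have hk0 : 0 ≤ k := hk ▸ intervalIntegral.integral_nonneg zero_le_one h0
  have hk1 : k ≤ 1 := by
    have : ∫ t in (0 : ℝ)..1, f t ≤ ∫ t in (0 : ℝ)..1, (2 + (-2) * t + 0 * t ^ 2 + 0 * t ^ 3) := by
      refine intervalIntegral.integral_mono_on zero_le_one hint
        (Continuous.intervalIntegrable (by fun_prop) _ _) fun t ht => ?_
      linarith [htent t ht]
    rw [integral_cubic, hk] at this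
    norm_num at this
    exact this
  refine ⟨hk0, hk1, ?_⟩
  -- The extremal profile is the tent truncated at height `2 * (1 - m)`. Its area is `1 - m ^ 2`,
  -- which dictates the choice of `m`.
  set m := √(1 - k) with hm
  have hm2 : m ^ 2 = 1 - k := Real.sq_sqrt (by linarith)
  have hm0 : 0 ≤ m := Real.sqrt_nonneg _
  have hm1 : m ≤ 1 := by nlinarith
  set T : ℝ → ℝ := fun t => min (2 * (1 - m)) (2 * (1 - t)) with hT
  have hTc : Continuous T := by fun_prop
  have left : ∀ t ∈ Set.uIcc 0 m, T t = 2 * (1 - m) := by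
    intro t ht
    rw [Set.uIcc_of_le hm0] at ht
    exact min_eq_left (by linarith [ht.2])
  have right : ∀ t ∈ Set.uIcc m 1, T t = 2 * (1 - t) := by
    intro t ht
    rw [Set.uIcc_of_le hm1] at ht
    exact min_eq_right (by linarith [ht.1])
  have integral_T : ∫ t in (0 : ℝ)..1, T t = k := by
    rw [← intervalIntegral.integral_add_adjacent_intervals (b := m)
      (hTc.intervalIntegrable _ _) (hTc.intervalIntegrable _ _),
      intervalIntegral.integral_congr (a := m)
        (g := fun t => 2 + (-2) * t + 0 * t ^ 2 + 0 * t ^ 3)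
        fun t ht => by simp only [right t ht]; ring,
      intervalIntegral.integral_congr (a := 0)
        (g := fun t => 2 * (1 - m) + 0 * t + 0 * t ^ 2 + 0 * t ^ 3)
        fun t ht => by simp only [left t ht]; ring,
      integral_cubic, integral_cubic]
    linear_combination -hm2
  have integral_sq_T : ∫ t in (0 : ℝ)..1, t ^ 2 * T t = (2 * k - k ^ 2) / 6 := by
    rw [← intervalIntegral.integral_add_adjacent_intervals (b := m)
      ((by fun_prop : Continuous fun t => t ^ 2 * T t).intervalIntegrable _ _)
      ((by fun_prop : Continuous fun t => t ^ 2 * T t).intervalIntegrable _ _),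
      intervalIntegral.integral_congr (a := m)
        (g := fun t => 0 + 0 * t + 2 * t ^ 2 + (-2) * t ^ 3)
        fun t ht => by simp only [right t ht]; ring,
      intervalIntegral.integral_congr (a := 0)
        (g := fun t => 0 + 0 * t + 2 * (1 - m) * t ^ 2 + 0 * t ^ 3)
        fun t ht => by simp only [left t ht]; ring,
      integral_cubic, integral_cubic]
    linear_combination (-(m ^ 2 + 1 - k) / 6) * hm2
  rw [← integral_sq_T]
  refine integral_mul_le_of_single_crossing zero_le_one hint (hTc.intervalIntegrable _ _)
    (by fun_prop) (fun s hs t _ hst => by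
        have := hs.1
        gcongr) ?_ (by rw [hk, integral_T])
  intro s hs t ht hst hlt
  exact le_min ((hf hs ht hst.le).trans (hlt.le.trans (min_le_left _ _))) (htent t ht)

/-- Right minus left is 2 · `cubic` + 3 · `quartic` + `quintic` + hk · `bracket`. Equality at h = k
= 0 (the square) and at h = k = 1 (the diamond) leaves no slack at either end. -/
theorem cap_moment_polynomial_le {h k : ℝ} (h0 : 0 ≤ h) (h1 : h ≤ 1) (k0 : 0 ≤ k) (k1 : k ≤ 1) :
    (4 + 2 * k - k ^ 2 + 6 * h + 4 * h ^ 2 + h ^ 3) *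
      (4 + 2 * h - h ^ 2 + 6 * k + 4 * k ^ 2 + k ^ 3) ≤ (2 + h + k) ^ 4 := by
  have hk0 : 0 ≤ h * k := mul_nonneg h0 k0
  have hkh : h * k ≤ h := mul_le_of_le_one_right h0 k1
  have hkk : h * k ≤ k := mul_le_of_le_one_left k0 h1
  have hk1 : h * k ≤ 1 := hkh.trans h1
  have cubic : 0 ≤ (h + k) * (h - k) ^ 2 := by positivity
  have quartic : 0 ≤ (h ^ 2 + h * k + k ^ 2) * (h - k) ^ 2 := by positivity
  have quintic : 0 ≤ (h + k) * (h ^ 2 + h * k + k ^ 2) * (h - k) ^ 2 := by positivity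
  have bracket : 0 ≤ 8 + 4 * (h + k) + (h ^ 2 + k ^ 2) - 11 * (h * k) - 3 * (h * k) * (h + k)
      - (h * k) ^ 2 := by
    have h2 : 0 ≤ (4 - 3 * (h * k)) * (h + k - 2 * (h * k)) :=
      mul_nonneg (by linarith) (by linarith)
    have h3 : 0 ≤ (1 - h * k) * (8 + 7 * (h * k)) := mul_nonneg (by linarith) (by linarith)
    linarith [sq_nonneg (h - k)]
  linarith [mul_nonneg hk0 bracket]

/-! ### Sets between the square and the diamond, and their vertical sections. -/

/-- A closed convex symmetric planar set lying between the square `[-1,1]²` and the diamond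
`|x| + |y| ≤ 2`. -/
structure DiamondPosition (K : Set (ℝ × ℝ)) : Prop where
  convex : Convex ℝ K
  isClosed : IsClosed K
  symmetric : ∀ z ∈ K, -z ∈ K
  corner : ((1, 1) : ℝ × ℝ) ∈ K
  corner' : ((1, -1) : ℝ × ℝ) ∈ K
  diamond : ∀ z ∈ K, |z.1| + |z.2| ≤ 2

/-- The length of the vertical section of `K` at abscissa `t`. -/
noncomputable def sectionLength (K : Set (ℝ × ℝ)) (t : ℝ) : ℝ :=
  volume.real {q : ℝ | (t, q) ∈ K}

theorem setIntegral_fst_eq {K : Set (ℝ × ℝ)} (hK : MeasurableSet K) {g : ℝ → ℝ}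
    (hg : IntegrableOn (fun z : ℝ × ℝ => g z.1) K) :
    ∫ z in K, g z.1 = ∫ t, g t * sectionLength K t := by
  rw [← integral_indicator hK, Measure.volume_eq_prod, integral_prod]
  · refine integral_congr_ae (Filter.Eventually.of_forall fun t => ?_)
    have hm : MeasurableSet {q : ℝ | (t, q) ∈ K} := measurable_prodMk_left hK
    have : (fun q => K.indicator (fun z : ℝ × ℝ => g z.1) (t, q)) =
        {q : ℝ | (t, q) ∈ K}.indicator fun _ => g t := by
      ext q
      simp [Set.indicator]
    simp only [this]
    rw [integral_indicator hm, setIntegral_const, smul_eq_mul, mul_comm]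
    rfl
  · exact (integrable_indicator_iff hK).mpr hg

theorem integral_eq_two_mul_of_even {G : ℝ → ℝ} (heven : ∀ t, G (-t) = G t)
    (hsupp : ∀ t, 2 < t → G t = 0) :
    ∫ t, G t = 2 * ∫ t in (0 : ℝ)..2, G t := by
  have h1 : ∫ t, G t = 2 * ∫ t in Set.Ioi (0 : ℝ), G t := by
    rw [← integral_comp_abs]
    refine integral_congr_ae (Filter.Eventually.of_forall fun t => ?_)
    rcases abs_choice t with h | h <;> simp [h, heven]
  rw [h1, intervalIntegral.integral_of_le zero_le_two]
  congr 1
  refine (setIntegral_eq_of_subset_of_forall_sdiff_eq_zero measurableSet_Ioi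
    Set.Ioc_subset_Ioi_self fun t ht => hsupp t ?_)
  by_contra hle
  exact ht.2 ⟨ht.1, not_lt.mp hle⟩

namespace DiamondPosition

variable {K : Set (ℝ × ℝ)}

theorem swap (hK : DiamondPosition K) : DiamondPosition (Prod.swap ⁻¹' K) where
  convex := hK.convex.is_linear_preimage
    (LinearMap.isLinear (LinearEquiv.prodComm ℝ ℝ ℝ).toLinearMap)
  isClosed := hK.isClosed.preimage continuous_swap
  symmetric z hz := hK.symmetric _ hz
  corner := hK.corner
  corner' := by simpa using hK.symmetric _ hK.corner'
  diamond z hz := by simpa [add_comm] using hK.diamond _ hz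

theorem square_subset (hK : DiamondPosition K) :
    Set.Icc (-1 : ℝ) 1 ×ˢ Set.Icc (-1 : ℝ) 1 ⊆ K := by
  have edge : ∀ q ∈ Set.Icc (-1 : ℝ) 1, ((1, q) : ℝ × ℝ) ∈ K := by
    intro q hq
    have := hK.convex hK.corner hK.corner' (a := (1 + q) / 2) (b := (1 - q) / 2)
      (by linarith [hq.1]) (by linarith [hq.2]) (by ring)
    convert this using 1
    ext <;> simp <;> ring
  rintro ⟨p, q⟩ ⟨hp, hq⟩
  -- The left edge is the reflection of the right one: (-1, q) = -(1, -q).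
  have h2 := hK.symmetric _ (edge (-q) ⟨by linarith [hq.2], by linarith [hq.1]⟩)
  have := hK.convex (edge q hq) h2 (a := (1 + p) / 2) (b := (1 - p) / 2)
      (by linarith [hp.1]) (by linarith [hp.2]) (by ring)
  convert this using 1
  ext <;> simp <;> ring

theorem subset_box (hK : DiamondPosition K) :
    K ⊆ Set.Icc (-2 : ℝ) 2 ×ˢ Set.Icc (-2 : ℝ) 2 := by
  intro z hz
  have h := hK.diamond z hz
  have h1 := abs_nonneg z.1
  have h2 := abs_nonneg z.2
  exact ⟨abs_le.mp (by linarith), abs_le.mp (by linarith)⟩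

theorem isCompact (hK : DiamondPosition K) : IsCompact K :=
  (isCompact_Icc.prod isCompact_Icc).of_isClosed_subset hK.isClosed hK.subset_box

theorem integrableOn (hK : DiamondPosition K) {f : ℝ × ℝ → ℝ} (hf : Continuous f) :
    IntegrableOn f K :=
  hf.continuousOn.integrableOn_compact hK.isCompact

theorem section_eq_Icc (hK : DiamondPosition K) {t : ℝ} (ht : {q : ℝ | (t, q) ∈ K}.Nonempty) :
    ∃ a b : ℝ, a ≤ b ∧ {q : ℝ | (t, q) ∈ K} = Set.Icc a b := by
  set S := {q : ℝ | (t, q) ∈ K} with hS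
  have hconv : Convex ℝ S := by
    intro x hx y hy a b ha hb hab
    have := hK.convex hx hy ha hb hab
    change (t, a • x + b • y) ∈ K
    convert this using 1
    ext
    · simp [← add_mul, hab]
    · simp
  have hclosed : IsClosed S := hK.isClosed.preimage (Continuous.prodMk_right t)
  have hcomp : IsCompact S :=
    isCompact_Icc.of_isClosed_subset hclosed fun q hq => (hK.subset_box hq).2
  have h := eq_Icc_of_connected_compact ⟨ht, hconv.isPreconnected⟩ hcomp
  refine ⟨sInf S, sSup S, ?_, h⟩
  rw [h] at ht
  exact Set.nonempty_Icc.mp ht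

theorem sectionLength_nonneg (K : Set (ℝ × ℝ)) (t : ℝ) : 0 ≤ sectionLength K t :=
  measureReal_nonneg

/-- Brunn's principle in the plane: convex combinations of the lower endpoints and of the upper
endpoints of two sections both lie in the intermediate section. -/
theorem sectionLength_concave (hK : DiamondPosition K) {s t a b : ℝ}
    (hs : {q : ℝ | (s, q) ∈ K}.Nonempty) (ht : {q : ℝ | (t, q) ∈ K}.Nonempty)
    (ha : 0 ≤ a) (hb : 0 ≤ b) (hab : a + b = 1) :
    a * sectionLength K s + b * sectionLength K t ≤ sectionLength K (a * s + b * t) := by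
  obtain ⟨α, β, hαβ, h1⟩ := hK.section_eq_Icc hs
  obtain ⟨γ, δ, hγδ, h2⟩ := hK.section_eq_Icc ht
  have mix : ∀ x ∈ Set.Icc α β, ∀ y ∈ Set.Icc γ δ,
      a * x + b * y ∈ {q : ℝ | (a * s + b * t, q) ∈ K} := by
    intro x hx y hy
    rw [← h1] at hx
    rw [← h2] at hy
    exact hK.convex hx hy ha hb hab
  have hlow := mix α ⟨le_rfl, hαβ⟩ γ ⟨le_rfl, hγδ⟩
  have hupp := mix β ⟨hαβ, le_rfl⟩ δ ⟨hγδ, le_rfl⟩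
  obtain ⟨ε, ζ, hεζ, h3⟩ := hK.section_eq_Icc ⟨_, hlow⟩
  rw [h3] at hlow hupp
  simp only [sectionLength, h1, h2, h3, Real.volume_real_Icc_of_le, hαβ, hγδ, hεζ]
  linarith [hlow.1, hupp.2]

theorem sectionLength_neg (hK : DiamondPosition K) (t : ℝ) :
    sectionLength K (-t) = sectionLength K t := by
  have : {q : ℝ | (-t, q) ∈ K} = -{q : ℝ | (t, q) ∈ K} := by
    ext q
    simp only [Set.mem_ofPred_eq, Set.mem_neg]
    exact ⟨fun h => by simpa using hK.symmetric _ h, fun h => by simpa using hK.symmetric _ h⟩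
  simp only [sectionLength, Measure.real, this, Measure.measure_neg]

theorem nonempty_of_sectionLength_pos {t : ℝ} (h : 0 < sectionLength K t) :
    {q : ℝ | (t, q) ∈ K}.Nonempty := by
  by_contra hne
  rw [Set.not_nonempty_iff_eq_empty] at hne
  simp [sectionLength, hne] at h

/-- The section length is even and concave where sections are nonempty, and `s` is a convex
combination of `t` and `-t`. -/
theorem sectionLength_antitoneOn (hK : DiamondPosition K) :
    AntitoneOn (sectionLength K) (Set.Ici 0) := by
  intro s hs t ht hst
  rcases (sectionLength_nonneg K t).eq_or_lt with h | h
  · exact h ▸ sectionLength_nonneg K s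
  rcases (Set.mem_Ici.mp ht).eq_or_lt with h0 | h0
  · rw [le_antisymm (h0 ▸ hst : s ≤ 0) hs, ← h0]
  have hneg : 0 < sectionLength K (-t) := by rwa [hK.sectionLength_neg]
  have hs0 : 0 ≤ s := hs
  have hdiv : s / t ≤ 1 := (div_le_one h0).mpr hst
  have hdiv0 : 0 ≤ s / t := by positivity
  have := hK.sectionLength_concave (nonempty_of_sectionLength_pos h)
    (nonempty_of_sectionLength_pos hneg) (a := (1 + s / t) / 2) (b := (1 - s / t) / 2)
    (by linarith) (by linarith) (by ring)
  rw [hK.sectionLength_neg] at this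
  calc sectionLength K t
      = (1 + s / t) / 2 * sectionLength K t + (1 - s / t) / 2 * sectionLength K t := by ring
    _ ≤ _ := this
    _ = sectionLength K s := by congr 1; field_simp; ring

theorem sectionLength_le (hK : DiamondPosition K) {t : ℝ} (h0 : 0 ≤ t) (h2 : t ≤ 2) :
    sectionLength K t ≤ 4 - 2 * t := by
  have hsub : {q : ℝ | (t, q) ∈ K} ⊆ Set.Icc (-(2 - t)) (2 - t) := by
    intro q hq
    have h := hK.diamond _ hq
    rw [abs_of_nonneg h0] at h
    exact abs_le.mp (by simp only at h; linarith)
  refine (measureReal_mono hsub (by simp)).trans (le_of_eq ?_)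
  rw [Real.volume_real_Icc_of_le (by linarith)]
  ring

theorem sectionLength_eq_zero (hK : DiamondPosition K) {t : ℝ} (ht : 2 < t) :
    sectionLength K t = 0 := by
  by_contra hne
  obtain ⟨q, hq⟩ := nonempty_of_sectionLength_pos
    ((sectionLength_nonneg K t).lt_of_ne (Ne.symm hne))
  exact absurd (hK.subset_box hq).1.2 (not_le.mpr ht)

theorem two_le_sectionLength (hK : DiamondPosition K) {t : ℝ} (ht : t ∈ Set.Icc (-1 : ℝ) 1) :
    2 ≤ sectionLength K t := by
  have hsub : Set.Icc (-1 : ℝ) 1 ⊆ {q : ℝ | (t, q) ∈ K} := fun q hq =>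
    hK.square_subset ⟨ht, hq⟩
  have hfin : volume {q : ℝ | (t, q) ∈ K} ≠ ⊤ :=
    ((measure_mono (t := Set.Icc (-2 : ℝ) 2) fun q hq => (hK.subset_box hq).2).trans_lt
      measure_Icc_lt_top).ne
  have := measureReal_mono hsub hfin
  rw [Real.volume_real_Icc_of_le (by norm_num)] at this
  exact le_trans (by norm_num) this

/-- Concavity between abscissa 1, where the edge of the square gives length at least 2, and `t`. -/
theorem sectionLength_star (hK : DiamondPosition K) {s t : ℝ} (hs : 1 ≤ s) (hst : s < t)
    (ht : 0 < sectionLength K t) :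
    2 * (t - s) / (t - 1) + (s - 1) / (t - 1) * sectionLength K t ≤ sectionLength K s := by
  have ht1 : 0 < t - 1 := by linarith
  have h1 : 0 ≤ (t - s) / (t - 1) := div_nonneg (by linarith) ht1.le
  have h2 : 0 ≤ (s - 1) / (t - 1) := div_nonneg (by linarith) ht1.le
  have := hK.sectionLength_concave (s := 1) ⟨1, hK.corner⟩ (nonempty_of_sectionLength_pos ht)
    h1 h2 (by field_simp; ring)
  have hpt : (t - s) / (t - 1) * 1 + (s - 1) / (t - 1) * t = s := by field_simp; ring
  rw [hpt] at this
  refine le_trans (add_le_add_left ?_ _) this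
  rw [mul_comm 2, mul_div_right_comm]
  exact mul_le_mul_of_nonneg_left (hK.two_le_sectionLength ⟨by norm_num, le_rfl⟩) h1

theorem sectionLength_intervalIntegrable (hK : DiamondPosition K) {a b : ℝ} (ha : 0 ≤ a)
    (hb : 0 ≤ b) : IntervalIntegrable (sectionLength K) volume a b :=
  (hK.sectionLength_antitoneOn.mono fun _ hx => (le_min ha hb).trans hx.1).intervalIntegrable

/-! ### Area and second moments through section lengths. -/

theorem setIntegral_fst (hK : DiamondPosition K) {g : ℝ → ℝ} (hg : Continuous g)
    (heven : ∀ t, g (-t) = g t) :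
    ∫ z in K, g z.1 = 2 * ∫ t in (0 : ℝ)..2, g t * sectionLength K t := by
  rw [setIntegral_fst_eq hK.isClosed.measurableSet
    (hK.integrableOn (hg.comp continuous_fst)), integral_eq_two_mul_of_even]
  · intro t; rw [heven, hK.sectionLength_neg]
  · intro t ht; rw [hK.sectionLength_eq_zero ht, mul_zero]

theorem volume_eq (hK : DiamondPosition K) :
    volume.real K = 2 * ∫ t in (0 : ℝ)..2, sectionLength K t := by
  have := hK.setIntegral_fst (g := fun _ => 1) continuous_const fun _ => rfl
  simpa using this

theorem volume_caps_eq (hK : DiamondPosition K) :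
    volume.real (K ∩ {z | 1 < |z.1|}) = 2 * ∫ t in (1 : ℝ)..2, sectionLength K t := by
  have hm : MeasurableSet (K ∩ {z : ℝ × ℝ | 1 < |z.1|}) :=
    hK.isClosed.measurableSet.inter (measurableSet_lt measurable_const (by fun_prop))
  have hsec : ∀ t, sectionLength (K ∩ {z | 1 < |z.1|}) t =
      if 1 < |t| then sectionLength K t else 0 := by
    intro t
    split_ifs with h <;> simp [sectionLength, h]
  have h1 := setIntegral_fst_eq hm (g := fun _ => 1)
    ((hK.integrableOn continuous_const).mono_set Set.inter_subset_left)
  simp only [one_mul, setIntegral_const, smul_eq_mul, mul_one] at h1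
  have hint : IntervalIntegrable (sectionLength (K ∩ {z | 1 < |z.1|})) volume 0 1 :=
    (intervalIntegrable_const (c := 0)).congr fun t ht => by
      rw [Set.uIoc_of_le zero_le_one] at ht
      rw [hsec, if_neg]
      rw [abs_of_pos ht.1]
      exact not_lt.mpr ht.2
  have hint' : IntervalIntegrable (sectionLength (K ∩ {z | 1 < |z.1|})) volume 1 2 :=
    (hK.sectionLength_intervalIntegrable zero_le_one zero_le_two).congr fun t ht => by
      rw [Set.uIoc_of_le one_le_two] at ht
      rw [hsec, if_pos]
      rw [abs_of_pos (by linarith [ht.1])]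
      exact ht.1
  rw [h1, integral_eq_two_mul_of_even, ← intervalIntegral.integral_add_adjacent_intervals hint hint']
  · have e1 : ∫ t in (0 : ℝ)..1, sectionLength (K ∩ {z | 1 < |z.1|}) t = 0 := by
      rw [intervalIntegral.integral_of_le zero_le_one]
      refine setIntegral_eq_zero_of_forall_eq_zero fun t ht => ?_
      rw [hsec, if_neg]
      rw [abs_of_pos ht.1]
      exact not_lt.mpr ht.2
    have e2 : ∫ t in (1 : ℝ)..2, sectionLength (K ∩ {z | 1 < |z.1|}) t =
        ∫ t in (1 : ℝ)..2, sectionLength K t := by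
      rw [intervalIntegral.integral_of_le one_le_two, intervalIntegral.integral_of_le one_le_two]
      refine setIntegral_congr_fun measurableSet_Ioc fun t ht => ?_
      simp only [hsec]
      rw [if_pos]
      rw [abs_of_pos (by linarith [ht.1])]
      exact ht.1
    rw [e1, e2, zero_add]
  · intro t; simp only [hsec, abs_neg, hK.sectionLength_neg]
  · intro t ht; simp [hsec, hK.sectionLength_eq_zero ht]

theorem volume_decomposition (hK : DiamondPosition K) :
    volume.real K = 4 + volume.real (K ∩ {z | 1 < |z.1|}) + volume.real (K ∩ {z | 1 < |z.2|}) := by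
  have hm1 : MeasurableSet (K ∩ {z : ℝ × ℝ | 1 < |z.1|}) :=
    hK.isClosed.measurableSet.inter (measurableSet_lt measurable_const (by fun_prop))
  have hm2 : MeasurableSet (K ∩ {z : ℝ × ℝ | 1 < |z.2|}) :=
    hK.isClosed.measurableSet.inter (measurableSet_lt measurable_const (by fun_prop))
  have hfin : ∀ s ⊆ K, volume s ≠ ⊤ := fun s hs =>
    ((measure_mono hs).trans_lt hK.isCompact.measure_lt_top).ne
  have hdec : K = (Set.Icc (-1 : ℝ) 1 ×ˢ Set.Icc (-1 : ℝ) 1 ∪ K ∩ {z | 1 < |z.1|}) ∪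
      K ∩ {z | 1 < |z.2|} := by
    apply Set.Subset.antisymm
    · intro z hz
      by_cases h1 : 1 < |z.1|
      · exact Or.inl (Or.inr ⟨hz, h1⟩)
      by_cases h2 : 1 < |z.2|
      · exact Or.inr ⟨hz, h2⟩
      · exact Or.inl (Or.inl ⟨abs_le.mp (not_lt.mp h1), abs_le.mp (not_lt.mp h2)⟩)
    · exact Set.union_subset (Set.union_subset hK.square_subset Set.inter_subset_left)
        Set.inter_subset_left
  have hd1 : Disjoint (Set.Icc (-1 : ℝ) 1 ×ˢ Set.Icc (-1 : ℝ) 1) (K ∩ {z | 1 < |z.1|}) :=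
    Set.disjoint_left.mpr fun z hz hz' => absurd hz'.2 (not_lt.mpr (abs_le.mpr hz.1))
  have hd2 : Disjoint (Set.Icc (-1 : ℝ) 1 ×ˢ Set.Icc (-1 : ℝ) 1 ∪ K ∩ {z | 1 < |z.1|})
      (K ∩ {z | 1 < |z.2|}) := by
    refine Set.disjoint_left.mpr fun z hz hz' => ?_
    have h2 : 1 < |z.2| := hz'.2
    rcases hz with hz | hz
    · exact absurd h2 (not_lt.mpr (abs_le.mpr hz.2))
    · have h1 : 1 < |z.1| := hz.2
      -- A point in both kinds of caps would have |x| + |y| > 2.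
      linarith [hK.diamond z hz'.1]
  have hsq : volume.real (Set.Icc (-1 : ℝ) 1 ×ˢ Set.Icc (-1 : ℝ) 1) = 4 := by
    rw [Measure.volume_eq_prod, measureReal_prod_prod, Real.volume_real_Icc_of_le (by norm_num)]
    norm_num
  calc volume.real K = _ := congrArg volume.real hdec
    _ = _ := by
      rw [measureReal_union hd2 hm2
          (hfin _ (Set.union_subset hK.square_subset Set.inter_subset_left))
          (hfin _ Set.inter_subset_left),
        measureReal_union hd1 hm1 (hfin _ hK.square_subset) (hfin _ Set.inter_subset_left), hsq]

theorem setIntegral_fst_sq_le (hK : DiamondPosition K) {h k : ℝ}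
    (hh : volume.real (K ∩ {z | 1 < |z.1|}) = 2 * h)
    (hk : volume.real (K ∩ {z | 1 < |z.2|}) = 2 * k) :
    0 ≤ k ∧ k ≤ 1 ∧ 0 ≤ h ∧ h ≤ 1 ∧
      ∫ z in K, z.1 ^ 2 ≤ (4 + 2 * k - k ^ 2 + 6 * h + 4 * h ^ 2 + h ^ 3) / 3 := by
  set L := sectionLength K with hL
  have i01 : IntervalIntegrable L volume 0 1 :=
    hK.sectionLength_intervalIntegrable le_rfl zero_le_one
  have i12 : IntervalIntegrable L volume 1 2 :=
    hK.sectionLength_intervalIntegrable zero_le_one zero_le_two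
  have hh' : ∫ t in (1 : ℝ)..2, L t = h := by linarith [hK.volume_caps_eq]
  -- Over |t| ≤ 1 the excess of a section over the square is its part in the top and bottom caps,
  -- whose total area is 2k.
  have hk' : ∫ t in (0 : ℝ)..1, (L t - 2) = k := by
    have h1 := hK.volume_eq
    rw [← intervalIntegral.integral_add_adjacent_intervals i01 i12, hK.volume_decomposition] at h1
    rw [intervalIntegral.integral_sub i01 intervalIntegrable_const,
      intervalIntegral.integral_const, smul_eq_mul]
    linarith
  have h0 : 0 ≤ h := hh' ▸ intervalIntegral.integral_nonneg one_le_two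
    fun t _ => sectionLength_nonneg K t
  have h1 : h ≤ 1 := by
    have : ∫ t in (1 : ℝ)..2, L t ≤ ∫ t in (1 : ℝ)..2, (4 + (-2) * t + 0 * t ^ 2 + 0 * t ^ 3) := by
      refine intervalIntegral.integral_mono_on one_le_two i12
        (Continuous.intervalIntegrable (by fun_prop) _ _) fun t ht => ?_
      linarith [hK.sectionLength_le (by linarith [ht.1]) ht.2]
    rw [integral_cubic, hh'] at this
    norm_num at this
    exact this
  have side := integral_sq_mul_le_of_starConcave i12 (sectionLength_nonneg K) h1
    (fun s t hs hst ht => hK.sectionLength_star hs hst ht) hh'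
  obtain ⟨k0, k1, top⟩ := integral_sq_mul_le_of_antitone (f := fun t => L t - 2) (k := k)
    (fun s hs t ht hst => sub_le_sub_right (hK.sectionLength_antitoneOn hs.1 ht.1 hst) 2)
    (fun t ht => sub_nonneg.mpr (hK.two_le_sectionLength ⟨by linarith [ht.1], ht.2⟩))
    (fun t ht => by linarith [hK.sectionLength_le ht.1 (by linarith [ht.2])]) hk'
  refine ⟨k0, k1, h0, h1, ?_⟩
  have hsplit : ∫ t in (0 : ℝ)..1, t ^ 2 * L t = (∫ t in (0 : ℝ)..1, t ^ 2 * (L t - 2)) + 2 / 3 := by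
    have : ∫ t in (0 : ℝ)..1, (0 + 0 * t + 2 * t ^ 2 + 0 * t ^ 3) = 2 / 3 := by
      rw [integral_cubic]; norm_num
    rw [← this, ← intervalIntegral.integral_add
      ((i01.sub intervalIntegrable_const).continuousOn_mul (by fun_prop))
      (Continuous.intervalIntegrable (by fun_prop) _ _)]
    exact intervalIntegral.integral_congr fun t _ => by ring
  rw [hK.setIntegral_fst (g := fun t => t ^ 2) (by fun_prop) (by simp),
    ← intervalIntegral.integral_add_adjacent_intervals (b := 1)
      (i01.continuousOn_mul (by fun_prop)) (i12.continuousOn_mul (by fun_prop)), hsplit]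
  linarith

theorem setIntegral_comp_swap (f : ℝ × ℝ → ℝ) :
    ∫ z in Prod.swap ⁻¹' K, f z.swap = ∫ z in K, f z :=
  (Measure.measurePreserving_swap (μ := (volume : Measure ℝ)) (ν := (volume : Measure ℝ))
    ).setIntegral_preimage_emb MeasurableEquiv.prodComm.measurableEmbedding f K

theorem moments_mul_le (hK : DiamondPosition K) :
    144 * ((∫ z in K, z.1 ^ 2) * ∫ z in K, z.2 ^ 2) ≤ volume.real K ^ 4 := by
  obtain ⟨h, hh⟩ : ∃ h, volume.real (K ∩ {z | 1 < |z.1|}) = 2 * h := ⟨_ / 2, by ring⟩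
  obtain ⟨k, hk⟩ : ∃ k, volume.real (K ∩ {z | 1 < |z.2|}) = 2 * k := ⟨_ / 2, by ring⟩
  have volume_swap : ∀ S : Set (ℝ × ℝ), volume.real (Prod.swap ⁻¹' S) = volume.real S := by
    intro S
    simpa using setIntegral_comp_swap (K := S) fun _ => 1
  obtain ⟨k0, k1, h0, h1, m1⟩ := hK.setIntegral_fst_sq_le hh hk
  obtain ⟨-, -, -, -, m2⟩ := hK.swap.setIntegral_fst_sq_le (h := k) (k := h)
    (by rw [← hk, ← volume_swap]; rfl) (by rw [← hh, ← volume_swap]; rfl)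
  have e2 : ∫ z in Prod.swap ⁻¹' K, z.1 ^ 2 = ∫ z in K, z.2 ^ 2 :=
    setIntegral_comp_swap fun z => z.2 ^ 2
  rw [e2] at m2
  rw [hK.volume_decomposition, hh, hk]
  have hmul := mul_le_mul m1 m2 (integral_nonneg fun z => sq_nonneg _)
    ((integral_nonneg fun z => sq_nonneg _).trans m1)
  linarith [cap_moment_polynomial_le h0 h1 k0 k1]

/-- The second moments form the matrix of the quadratic form (a, b) ↦ ∫ (a x + b y)², which is
positive definite because `K` contains a neighbourhood of the origin. -/
theorem moments_det_pos (hK : DiamondPosition K) :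
    0 < (∫ z in K, z.1 ^ 2) * (∫ z in K, z.2 ^ 2) - (∫ z in K, z.1 * z.2) ^ 2 := by
  have quad : ∀ a b : ℝ, (a ≠ 0 ∨ b ≠ 0) → 0 < ∫ z in K, (a * z.1 + b * z.2) ^ 2 := by
    intro a b hab
    have hc : Continuous fun z : ℝ × ℝ => (a * z.1 + b * z.2) ^ 2 := by fun_prop
    rw [setIntegral_pos_iff_support_of_nonneg_ae
      (Filter.Eventually.of_forall fun z => sq_nonneg _) (hK.integrableOn hc)]
    have hopen : IsOpen (Function.support (fun z : ℝ × ℝ => (a * z.1 + b * z.2) ^ 2) ∩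
        Set.Ioo (-1 : ℝ) 1 ×ˢ Set.Ioo (-1 : ℝ) 1) :=
      hc.isOpen_support.inter (isOpen_Ioo.prod isOpen_Ioo)
    refine (hopen.measure_pos volume ?_).trans_le (measure_mono
      (Set.inter_subset_inter_right _ ((Set.prod_mono Set.Ioo_subset_Icc_self
        Set.Ioo_subset_Icc_self).trans hK.square_subset)))
    have hpos : 0 < a ^ 2 + b ^ 2 := by
      rcases hab with h | h <;> positivity
    -- Scaling by `r` moves (a, b) into the open square, where the linear form takes the value r (a²
    -- + b²) ≠ 0.
    set r := 1 / (1 + |a| + |b|) with hr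
    have hden : 0 < 1 + |a| + |b| := by positivity
    have hr0 : 0 < r := by positivity
    have small : ∀ x : ℝ, |x| ≤ |a| + |b| → r * x ∈ Set.Ioo (-1 : ℝ) 1 := by
      intro x hx
      rw [Set.mem_Ioo, ← abs_lt, abs_mul, abs_of_pos hr0, hr, one_div_mul_eq_div,
        div_lt_one hden]
      linarith
    refine ⟨(r * a, r * b), ?_, small a (by linarith [abs_nonneg b]),
      small b (by linarith [abs_nonneg a])⟩
    have : a * (r * a) + b * (r * b) = r * (a ^ 2 + b ^ 2) := by ring
    simp only [Function.mem_support, this]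
    positivity
  have expand : ∀ a b : ℝ, ∫ z in K, (a * z.1 + b * z.2) ^ 2 =
      a ^ 2 * (∫ z in K, z.1 ^ 2) + 2 * a * b * (∫ z in K, z.1 * z.2) +
        b ^ 2 * ∫ z in K, z.2 ^ 2 := by
    intro a b
    rw [← integral_const_mul, ← integral_const_mul, ← integral_const_mul, ← integral_add,
      ← integral_add]
    · congr 1; ext z; ring
    all_goals exact hK.integrableOn (by fun_prop)
  have h1 := quad 0 1 (Or.inr one_ne_zero)
  rw [expand] at h1
  -- At this vector the form equals the determinant times ∫ y².
  have h2 := quad (∫ z in K, z.2 ^ 2) (-∫ z in K, z.1 * z.2) (Or.inl (by linarith))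
  rw [expand] at h2
  have h3 : 0 < ∫ z in K, z.2 ^ 2 := by linarith
  refine (mul_pos_iff_of_pos_left h3).mp ?_
  linarith

end DiamondPosition

/-! ### Linear changes of coordinates, and the value for the square. -/

theorem setIntegral_linear_coordinates {K : Set (Fin 2 → ℝ)} (hK : MeasurableSet K)
    {c d : Fin 2 → ℝ} (hdet : c 0 * d 1 - d 0 * c 1 ≠ 0) {f : (Fin 2 → ℝ) → ℝ}
    (hf : Continuous f) :
    ∫ x in K, f x = |c 0 * d 1 - d 0 * c 1| *
      ∫ z in {z : ℝ × ℝ | z.1 • c + z.2 • d ∈ K}, f (z.1 • c + z.2 • d) := by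
  set N : Matrix (Fin 2) (Fin 2) ℝ := !![c 0, d 0; c 1, d 1] with hN
  have hNdet : N.det = c 0 * d 1 - d 0 * c 1 := by simp [hN, Matrix.det_fin_two]
  have happly : ∀ x : Fin 2 → ℝ, Matrix.toLin' N x = x 0 • c + x 1 • d := by
    intro x
    ext i
    fin_cases i <;>
      simp [hN, Matrix.toLin'_apply, Matrix.mulVec, dotProduct, Fin.sum_univ_two, mul_comm (x _)]
  have hcont : Continuous (Matrix.toLin' N) := LinearMap.continuous_of_finiteDimensional _
  have h1 := (volume_preserving_finTwoArrow ℝ).setIntegral_preimage_emb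
    (MeasurableEquiv.measurableEmbedding _)
    (fun z : ℝ × ℝ => f (z.1 • c + z.2 • d)) {z : ℝ × ℝ | z.1 • c + z.2 • d ∈ K}
  have h2 := setIntegral_map (μ := (volume : Measure (Fin 2 → ℝ))) (g := Matrix.toLin' N) hK
    hf.aestronglyMeasurable hcont.aemeasurable
  rw [Real.map_matrix_volume_pi_eq_smul_volume_pi (by rwa [hNdet]), Measure.restrict_smul,
    integral_smul_measure, hNdet, ENNReal.toReal_ofReal (abs_nonneg _), smul_eq_mul] at h2
  have h3 : ∫ x in Matrix.toLin' N ⁻¹' K, f (Matrix.toLin' N x) =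
      ∫ z in {z : ℝ × ℝ | z.1 • c + z.2 • d ∈ K}, f (z.1 • c + z.2 • d) := by
    rw [← h1]
    have : (Matrix.toLin' N ⁻¹' K) =
        MeasurableEquiv.finTwoArrow ⁻¹' {z : ℝ × ℝ | z.1 • c + z.2 • d ∈ K} := by
      ext x
      simp [happly, MeasurableEquiv.finTwoArrow]
    rw [this]
    simp only [happly]
    rfl
  rw [← h3, ← h2, abs_inv, mul_inv_cancel_left₀ (abs_ne_zero.mpr hdet)]

/-- Symmetry makes the means vanish, so the covariance is the normalized second-moment matrix. The
Jacobian enters |K|² and the determinant alike as its square and cancels. -/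
theorem slicingC_eq_of_linear_coordinates {K : Set (Fin 2 → ℝ)} (hK : MeasurableSet K)
    (hsymm : ∀ x, x ∈ K ↔ -x ∈ K) {c d : Fin 2 → ℝ} (hdet : c 0 * d 1 - d 0 * c 1 ≠ 0)
    {S : Set (ℝ × ℝ)} (hS : S = {z : ℝ × ℝ | z.1 • c + z.2 • d ∈ K})
    (hposition : DiamondPosition S) :
    slicingC K = volume.real S ^ 4 /
      ((∫ z in S, z.1 ^ 2) * (∫ z in S, z.2 ^ 2) - (∫ z in S, z.1 * z.2) ^ 2) := by
  have hdetpos := hposition.moments_det_pos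
  have hVpos : volume.real S ≠ 0 := by
    rw [hposition.volume_decomposition]
    positivity
  set J := |c 0 * d 1 - d 0 * c 1| with hJ
  have hJ2 : J ^ 2 = (c 0 * d 1 - d 0 * c 1) ^ 2 := sq_abs _
  have hJpos : J ≠ 0 := abs_ne_zero.mpr hdet
  have hvol : volume.real K = J * volume.real S := by
    simpa [← hS] using setIntegral_linear_coordinates hK hdet (f := fun _ => 1) continuous_const
  have hmean : ∀ i, ∫ x in K, x i = 0 := by
    intro i
    have h := (Measure.measurePreserving_neg (volume : Measure (Fin 2 → ℝ))).setIntegral_preimage_emb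
      (MeasurableEquiv.neg _).measurableEmbedding (fun x => x i) K
    have hpre : Neg.neg ⁻¹' K = K := by
      ext x
      exact (hsymm x).symm
    rw [hpre] at h
    simp only [Pi.neg_apply, integral_neg] at h
    linarith
  have hmom : ∀ i j, ∫ x in K, x i * x j = J * (c i * c j * (∫ z in S, z.1 ^ 2) +
      (c i * d j + d i * c j) * (∫ z in S, z.1 * z.2) + d i * d j * ∫ z in S, z.2 ^ 2) := by
    intro i j
    rw [setIntegral_linear_coordinates hK hdet (f := fun x => x i * x j) (by fun_prop), ← hS,
      ← integral_const_mul (c i * c j), ← integral_const_mul (c i * d j + d i * c j),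
      ← integral_const_mul (d i * d j), ← integral_add, ← integral_add]
    · congr 2
      ext z
      simp only [Pi.add_apply, Pi.smul_apply, smul_eq_mul]
      ring
    all_goals exact hposition.integrableOn (by fun_prop)
  have hcov : ∀ i j, covMatrix K i j = (J * volume.real S)⁻¹ * ∫ x in K, x i * x j := by
    intro i j
    simp [covMatrix, setAverage_eq, hmean, hvol]
  have hcovdet : (covMatrix K).det = J ^ 2 * ((∫ z in S, z.1 ^ 2) * (∫ z in S, z.2 ^ 2) -
      (∫ z in S, z.1 * z.2) ^ 2) / volume.real S ^ 2 := by
    rw [Matrix.det_fin_two, hcov, hcov, hcov, hcov, hmom, hmom, hmom, hmom]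
    field_simp
    rw [hJ2]
    ring
  rw [slicingC, hcovdet, hvol]
  have := hdetpos.ne'
  field_simp

theorem diamondPosition_square :
    DiamondPosition (Set.Icc (-1 : ℝ) 1 ×ˢ Set.Icc (-1 : ℝ) 1) where
  convex := (convex_Icc _ _).prod (convex_Icc _ _)
  isClosed := isClosed_Icc.prod isClosed_Icc
  symmetric z hz := by
    refine ⟨⟨?_, ?_⟩, ⟨?_, ?_⟩⟩ <;> simp only [Prod.fst_neg, Prod.snd_neg] <;>
      linarith [hz.1.1, hz.1.2, hz.2.1, hz.2.2]
  corner := by norm_num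
  corner' := by norm_num
  diamond z hz := by linarith [abs_le.mpr hz.1, abs_le.mpr hz.2]

theorem slicingC_cube_two : slicingC (cube 2) = 144 := by
  have hcube : cube 2 = Set.Icc (fun _ => -1) (fun _ => 1) := by
    ext x
    simp [cube, Set.mem_Icc, Pi.le_def, forall_and]
  have hS : Set.Icc (-1 : ℝ) 1 ×ˢ Set.Icc (-1 : ℝ) 1 =
      {z : ℝ × ℝ | z.1 • (![1, 0] : Fin 2 → ℝ) + z.2 • (![0, 1] : Fin 2 → ℝ) ∈ cube 2} := by
    ext z
    simp only [Set.mem_prod, Set.mem_Icc]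
    simp [cube, Fin.forall_fin_two]
  rw [slicingC_eq_of_linear_coordinates (hcube ▸ measurableSet_Icc) (fun x => by
      simp only [cube, Set.mem_ofPred_eq, Set.mem_Icc, Pi.neg_apply]
      refine forall_congr' fun i => ?_
      constructor <;> rintro ⟨h1, h2⟩ <;> constructor <;> linarith) (by simp) hS
      diamondPosition_square]
  have product : ∀ f g : ℝ → ℝ,
      ∫ z in Set.Icc (-1 : ℝ) 1 ×ˢ Set.Icc (-1 : ℝ) 1, f z.1 * g z.2 =
        (∫ t in (-1 : ℝ)..1, f t) * ∫ t in (-1 : ℝ)..1, g t := by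
    intro f g
    rw [Measure.volume_eq_prod, setIntegral_prod_mul, integral_Icc_eq_integral_Ioc,
      integral_Icc_eq_integral_Ioc, intervalIntegral.integral_of_le (by norm_num),
      intervalIntegral.integral_of_le (by norm_num)]
  have h0 := product (fun _ => 1) (fun _ => 1)
  have h1 := product (fun t => t ^ 2) (fun _ => 1)
  have h2 := product (fun _ => 1) (fun t => t ^ 2)
  have h3 := product (fun t => t) (fun t => t)
  simp only [mul_one, one_mul] at h0 h1 h2 h3
  rw [h1, h2, h3]
  simp only [setIntegral_const, smul_eq_mul, mul_one] at h0
  rw [h0]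
  norm_num [integral_pow, integral_id]

/-! ### The maximal parallelogram and the conclusion. -/

/-- A symmetric convex body contains a centrally symmetric parallelogram of maximal area, the
edges of which yield linear coordinates that put the body into diamond position. -/
theorem IsSymmetricConvexBody.exists_diamondPosition {K : Set (Fin 2 → ℝ)}
    (hK : IsSymmetricConvexBody K) :
    ∃ c d : Fin 2 → ℝ, c 0 * d 1 - d 0 * c 1 ≠ 0 ∧
      DiamondPosition {z : ℝ × ℝ | z.1 • c + z.2 • d ∈ K} := by
  obtain ⟨x₀, hx₀⟩ := hK.interior_nonempty
  have hne : (K ×ˢ K).Nonempty := ⟨(x₀, x₀), interior_subset hx₀, interior_subset hx₀⟩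
  obtain ⟨⟨a, b⟩, ⟨ha, hb⟩, hmax⟩ := (hK.isCompact.prod hK.isCompact).exists_isMaxOn hne
    (f := fun w : (Fin 2 → ℝ) × (Fin 2 → ℝ) => w.1 0 * w.2 1 - w.2 0 * w.1 1)
    (by fun_prop)
  have hle : ∀ x ∈ K, ∀ y ∈ K, x 0 * y 1 - y 0 * x 1 ≤ a 0 * b 1 - b 0 * a 1 :=
    fun x hx y hy => hmax (⟨hx, hy⟩ : (x, y) ∈ K ×ˢ K)
  have hneg : ∀ x ∈ K, -x ∈ K := fun x hx => (hK.symmetric x).mp hx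
  have hDpos : 0 < a 0 * b 1 - b 0 * a 1 := by
    obtain ⟨ε, hε, hball⟩ := Metric.isOpen_iff.mp isOpen_interior x₀ hx₀
    have shift : ∀ v : Fin 2 → ℝ, ‖v‖ < ε → x₀ + v ∈ K := fun v hv =>
      interior_subset (hball (by simpa [Metric.mem_ball, dist_eq_norm] using hv))
    have hnorm : ∀ (s : ℝ) (i : Fin 2), |s| < ε → ‖(Pi.single i s : Fin 2 → ℝ)‖ < ε := by
      intro s i hs
      rwa [Pi.norm_single, Real.norm_eq_abs]
    have hhalf : |ε / 2| < ε := by rw [abs_of_pos (by linarith)]; linarith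
    have hhalf' : |-(ε / 2)| < ε := by rwa [abs_neg]
    -- For the shifts by +ε/2 and by -ε/2 along the axes, the terms linear in ε cancel in the sum of
    -- the two determinants, leaving ε²/2 > 0.
    have h1 := hle _ (shift _ (hnorm _ 0 hhalf)) _ (shift _ (hnorm _ 1 hhalf))
    have h2 := hle _ (shift _ (hnorm _ 0 hhalf')) _ (shift _ (hnorm _ 1 hhalf'))
    simp at h1 h2
    nlinarith [sq_pos_of_pos hε]
  set D := a 0 * b 1 - b 0 * a 1 with hD
  -- With this basis `a = c + d` and `b = c - d` get coordinates (1,1) and (1,-1).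
  refine ⟨(1 / 2 : ℝ) • (a + b), (1 / 2 : ℝ) • (a - b), ?_, ?_, ?_, ?_, ?_, ?_, ?_⟩
  · simp only [Pi.smul_apply, Pi.add_apply, Pi.sub_apply, smul_eq_mul]
    intro h
    linarith
  · intro z hz w hw s t hs ht hst
    have := hK.convex hz hw hs ht hst
    simp only [Set.mem_ofPred_eq] at this ⊢
    convert this using 1
    ext i
    simp
    ring
  · exact hK.isCompact.isClosed.preimage (by fun_prop)
  · intro z hz
    have := hneg _ hz
    simp only [Set.mem_ofPred_eq] at this ⊢
    convert this using 1
    ext i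
    simp
    ring
  · simp only [Set.mem_ofPred_eq]
    convert ha using 1
    ext i
    simp
    ring
  · simp only [Set.mem_ofPred_eq]
    convert hb using 1
    ext i
    simp
    ring
  · intro z hz
    -- In these coordinates det(z, b) = (z₁ + z₂) D/2 and det(a, z) = (z₁ - z₂) D/2, so maximality
    -- applied to z and -z gives |z₁ ± z₂| ≤ 2.
    have hz' := hneg _ hz
    have h1 := hle _ hz _ hb
    have h2 := hle _ hz' _ hb
    have h3 := hle _ ha _ hz
    have h4 := hle _ ha _ hz'
    simp only [Pi.smul_apply, Pi.add_apply, Pi.sub_apply, Pi.neg_apply, smul_eq_mul] at h1 h2 h3 h4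
    have e1 : z.1 + z.2 ≤ 2 := le_of_mul_le_mul_right (by linarith) hDpos
    have e2 : -(z.1 + z.2) ≤ 2 := le_of_mul_le_mul_right (by linarith) hDpos
    have e3 : z.1 - z.2 ≤ 2 := le_of_mul_le_mul_right (by linarith) hDpos
    have e4 : -(z.1 - z.2) ≤ 2 := le_of_mul_le_mul_right (by linarith) hDpos
    rcases abs_cases z.1 with ⟨h, -⟩ | ⟨h, -⟩ <;> rcases abs_cases z.2 with ⟨h', -⟩ | ⟨h', -⟩ <;>
      rw [h, h'] <;> linarith

theorem mainTheorem6 :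
    (∀ K : Set (Fin 2 → ℝ), IsSymmetricConvexBody K →
      slicingC K ≥ slicingC (cube 2)) ∧
    slicingC (cube 2) = 144 := by
  refine ⟨fun K hK => ?_, slicingC_cube_two⟩
  obtain ⟨c, d, hdet, hposition⟩ := hK.exists_diamondPosition
  rw [slicingC_cube_two, slicingC_eq_of_linear_coordinates hK.isCompact.measurableSet hK.symmetric
    hdet rfl hposition, ge_iff_le, le_div_iff₀ hposition.moments_det_pos]
  refine le_trans ?_ hposition.moments_mul_le
  gcongr
  -- Discarding the squared mixed moment only enlarges the determinant.
  exact sub_le_self _ (sq_nonneg _)
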